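/- Let $\alpha$ be an ordinal. A relation $<^*$ on $\alpha$ is called *MSO-definable* if there are a monadic second-order formula $\varphi(x,y,X_0,\dots,X_{l-1})$ in the language $\{<\}$ (with quantification over elements and over arbitrary subsets) and parameters $Q_0,\dots,Q_{l-1}\subseteq\alpha$ such that $x<^*y \iff (\alpha,<)\models\varphi(x,y,Q_0,\dots,Q_{l-1})$ for all $x,y\in\alpha$. Then, up to isomorphism, the MSO-definable well-orderings of $\alpha$ are exactly the orders obtained by the following process: let $\langle P_0,\dots,P_{n-1}\rangle$ ($n<\omega$) be a partition of $\alpha$ into nonempty sets and put $$i<_P j \iff \big[(\exists k<n)\,(i\in P_k\ \&\ j\in P_k\ \&\ i<j)\big]\ \vee\ \big[(\exists k_1<k_2<n)\,(i\in P_{k_1}\ \&\ j\in P_{k_2})\big].$$ That is: every MSO-definable well-ordering $<^*$ of $\alpha$ satisfies $(\alpha,<^*)\cong(\alpha,<_P)$ for some such finite partition, and conversely every such $<_P$ is an MSO-definable well-ordering of $\alpha$. -/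

import Mathlib

/-- Formulas of monadic second-order logic in the language `{<}` of order whose free variables are
`m` element variables and `l` set variables (both counted in de Bruijn style: a quantifier binds
the variable with index `0` and shifts the others up by one). Disjunction, implication and the
universal quantifiers are expressed through the connectives below. -/
inductive MSOFormula : ℕ → ℕ → Type
  | lt {m l : ℕ} (i j : Fin m) : MSOFormula m l
  | eq {m l : ℕ} (i j : Fin m) : MSOFormula m l
  | mem {m l : ℕ} (i : Fin m) (X : Fin l) : MSOFormula m l
  | neg {m l : ℕ} (φ : MSOFormula m l) : MSOFormula m l
  | and {m l : ℕ} (φ ψ : MSOFormula m l) : MSOFormula m l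
  | existsElem {m l : ℕ} (φ : MSOFormula (m + 1) l) : MSOFormula m l
  | existsSet {m l : ℕ} (φ : MSOFormula m (l + 1)) : MSOFormula m l

/-- Satisfaction in `(C, <)` under the assignment `v` of elements and the assignment `V` of
subsets; set quantifiers range over all subsets of `C`. -/
def MSOFormula.Sat {C : Type*} [LT C] :
    {m l : ℕ} → MSOFormula m l → (Fin m → C) → (Fin l → Set C) → Prop
  | _, _, .lt i j, v, _ => v i < v j
  | _, _, .eq i j, v, _ => v i = v j
  | _, _, .mem i X, v, V => v i ∈ V X
  | _, _, .neg φ, v, V => ¬ φ.Sat v V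
  | _, _, .and φ ψ, v, V => φ.Sat v V ∧ ψ.Sat v V
  | _, _, .existsElem φ, v, V => ∃ a : C, φ.Sat (Fin.cons a v) V
  | _, _, .existsSet φ, v, V => ∃ A : Set C, φ.Sat v (Fin.cons A V)

/-- `R` is definable in `(C, <)` by a monadic second-order formula `φ(x, y, Q₀, …, Q_{l-1})`
with finitely many subsets `Q₀, …, Q_{l-1}` of `C` as parameters. -/
def MSODefinable {C : Type*} [LT C] (R : C → C → Prop) : Prop :=
  ∃ (l : ℕ) (φ : MSOFormula 2 l) (Q : Fin l → Set C), ∀ x y : C, R x y ↔ φ.Sat ![x, y] Q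

/-- `P₀, …, P_{n-1}` is a partition of `C` (into nonempty blocks). -/
def IsFinPartition {C : Type*} {n : ℕ} (P : Fin n → Set C) : Prop :=
  (∀ k, (P k).Nonempty) ∧ (∀ k₁ k₂, k₁ ≠ k₂ → Disjoint (P k₁) (P k₂)) ∧ ⋃ k, P k = Set.univ

/-- The order that lists `P₀` in its natural order, then `P₁`, and so on. -/
def blockOrder {C : Type*} [LT C] {n : ℕ} (P : Fin n → Set C) (i j : C) : Prop :=
  (∃ k, i ∈ P k ∧ j ∈ P k ∧ i < j) ∨ (∃ k₁ k₂, i ∈ P k₁ ∧ j ∈ P k₂ ∧ k₁ < k₂)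

-- Cut `C` into a lower set `A` and its complement. By the composition theorem, `R x y` for `x` in
-- `A` and `y` outside depends only on one of finitely many types of each point, so `R` alternates
-- between the two sides a bounded number of times, uniformly in the cut
-- (`MSODefinable.exists_cutsFinitely`).
--
-- This forces `<` and `R` to agree in scale: `<`-type at least `ω ^ γ * n` gives `R`-type at least
-- `ω ^ γ * n` (`CutsFinitely.opow_mul_le_otp`), and `<`-type below `ω ^ γ` gives `R`-type below `ω
-- ^ γ` (`CutsFinitely.otp_lt_opow`). So if an infinite `α` has leading term `ω ^ γ * n`, then `R`
-- has type in `[ω ^ γ * n, ω ^ (γ + 1))`. Sorting by finitely many colours reaches every ordinal of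
-- that interval, since `k * ω ^ γ = ω ^ γ` and smaller remainders are absorbed
-- (`Rearranges.of_opow_mul_le`).
--
-- Conversely, the definition of a block order is itself a formula with the blocks as parameters.

universe u

open Set Ordinal

/-! ### Composition theorem for monadic second-order logic -/

/-- The assignment of element variables seen from inside `A`: variables outside `A` are dropped. -/
noncomputable def restrictElems {C : Type*} (A : Set C) {m : ℕ} (v : Fin m → C) :
    Fin m → Option A :=
  open Classical in fun i => if h : v i ∈ A then some ⟨v i, h⟩ else none

/-- The trace on `A` of an assignment of set variables. -/
def restrictSets {C : Type*} (A : Set C) {l : ℕ} (V : Fin l → Set C) : Fin l → Set A :=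
  fun i => Subtype.val ⁻¹' V i

theorem restrictElems_cons_mem {C : Type*} {A : Set C} {m : ℕ} (v : Fin m → C) {x : C}
    (hx : x ∈ A) : restrictElems A (Fin.cons x v : Fin (m + 1) → C) =
      Fin.cons (some ⟨x, hx⟩) (restrictElems A v) := by
  funext i
  exact Fin.cases (by simp [restrictElems, hx]) (fun _ => rfl) i

theorem restrictElems_cons_notMem {C : Type*} {A : Set C} {m : ℕ} (v : Fin m → C) {x : C}
    (hx : x ∉ A) : restrictElems A (Fin.cons x v : Fin (m + 1) → C) =
      Fin.cons none (restrictElems A v) := by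
  funext i
  exact Fin.cases (by simp [restrictElems, hx]) (fun _ => rfl) i

theorem restrictSets_cons {C : Type*} {A : Set C} {l : ℕ} (V : Fin l → Set C) (X : Set C) :
    restrictSets A (Fin.cons X V : Fin (l + 1) → Set C) =
      Fin.cons (Subtype.val ⁻¹' X) (restrictSets A V) := by
  funext i
  refine Fin.cases ?_ (fun i => ?_) i <;> simp [restrictSets]

/-- Composition theorem for a sum of two linear orders: the truth value of a monadic second-order
formula is determined by finitely many invariants of the two summands, and the number of
these invariants depends only on the formula. -/
theorem MSOFormula.composition {m l : ℕ} (φ : MSOFormula m l) :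
    ∃ T : Type, Finite T ∧ ∀ (C : Type u) [LinearOrder C] (A : Set C), IsLowerSet A →
      ∃ (a : (Fin m → Option A) → (Fin l → Set A) → T)
        (b : (Fin m → Option ↥Aᶜ) → (Fin l → Set ↥Aᶜ) → T) (Rel : T → T → Prop),
        ∀ v V, φ.Sat v V ↔
          Rel (a (restrictElems A v) (restrictSets A V))
            (b (restrictElems Aᶜ v) (restrictSets Aᶜ V)) := by
  induction φ with
  | lt i j =>
    refine ⟨Prop × Prop, inferInstance, fun C _ A hA => ?_⟩
    -- The second component on the `A` side records `v i ∈ A`, `v j ∉ A`, where `<` is automatic; on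
    -- the other side it is padding.
    refine ⟨fun v _ => (∃ x y, v i = some x ∧ v j = some y ∧ x < y, (v i).isSome ∧ v j = none),
      fun v _ => (∃ x y, v i = some x ∧ v j = some y ∧ x < y, True),
      fun s t => s.1 ∨ s.2 ∨ t.1, fun v V => ?_⟩
    simp only [MSOFormula.Sat]
    by_cases hi : v i ∈ A <;> by_cases hj : v j ∈ A
    · simp [restrictElems, hi, hj]
    · simp only [restrictElems, hi, hj]
      have : v i < v j := by
        by_contra h
        exact hj (hA (not_lt.1 h) hi)
      simp [this]
    · simp only [restrictElems, hi, hj]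
      have : ¬ v i < v j := fun h => hi (hA h.le hj)
      simp [this, hi]
    · simp [restrictElems, hi, hj]
  | eq i j =>
    refine ⟨Prop, inferInstance, fun C _ A hA => ?_⟩
    refine ⟨fun v _ => (∃ x, v i = some x ∧ v j = some x),
      fun v _ => (∃ x, v i = some x ∧ v j = some x), fun s t => s ∨ t, fun v V => ?_⟩
    simp only [MSOFormula.Sat]
    by_cases hi : v i ∈ A <;> by_cases hj : v j ∈ A
    · simp [restrictElems, hi, hj, eq_comm]
    · have : v i ≠ v j := fun h => hj (h ▸ hi)
      simp [restrictElems, hi, hj, this]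
    · have : v i ≠ v j := fun h => hi (h ▸ hj)
      simp [restrictElems, hi, hj, this]
    · simp [restrictElems, hi, hj, eq_comm]
  | mem i X =>
    refine ⟨Prop, inferInstance, fun C _ A hA => ?_⟩
    refine ⟨fun v V => ∃ x, v i = some x ∧ x ∈ V X,
      fun v V => ∃ x, v i = some x ∧ x ∈ V X, fun s t => s ∨ t, fun v V => ?_⟩
    simp only [MSOFormula.Sat]
    by_cases hi : v i ∈ A <;> simp [restrictElems, restrictSets, hi]
  | neg φ ih =>
    obtain ⟨T, hT, ih⟩ := ih
    refine ⟨T, hT, fun C _ A hA => ?_⟩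
    obtain ⟨a, b, Rel, h⟩ := ih C A hA
    exact ⟨a, b, fun s t => ¬ Rel s t, fun v V => not_congr (h v V)⟩
  | and φ ψ ih₁ ih₂ =>
    obtain ⟨T₁, hT₁, ih₁⟩ := ih₁
    obtain ⟨T₂, hT₂, ih₂⟩ := ih₂
    refine ⟨T₁ × T₂, inferInstance, fun C _ A hA => ?_⟩
    obtain ⟨a₁, b₁, Rel₁, h₁⟩ := ih₁ C A hA
    obtain ⟨a₂, b₂, Rel₂, h₂⟩ := ih₂ C A hA
    exact ⟨fun v V => (a₁ v V, a₂ v V), fun v V => (b₁ v V, b₂ v V),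
      fun s t => Rel₁ s.1 t.1 ∧ Rel₂ s.2 t.2, fun v V => and_congr (h₁ v V) (h₂ v V)⟩
  | existsElem φ ih =>
    obtain ⟨T, hT, ih⟩ := ih
    -- The invariants attainable with the witness in this summand, and the invariant with the
    -- witness in the other.
    refine ⟨Set T × T, inferInstance, fun C _ A hA => ?_⟩
    obtain ⟨a, b, Rel, h⟩ := ih C A hA
    refine ⟨fun v V => (range fun x : A => a (Fin.cons (some x) v) V, a (Fin.cons none v) V),
      fun v V => (range fun x : ↥Aᶜ => b (Fin.cons (some x) v) V, b (Fin.cons none v) V),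
      fun s t => (∃ p ∈ s.1, Rel p t.2) ∨ ∃ q ∈ t.1, Rel s.2 q, fun v V => ?_⟩
    simp only [MSOFormula.Sat, h, exists_range_iff]
    constructor
    · rintro ⟨x, hx⟩
      by_cases hxA : x ∈ A
      · rw [restrictElems_cons_mem v hxA, restrictElems_cons_notMem v (not_not.2 hxA)] at hx
        exact Or.inl ⟨⟨x, hxA⟩, hx⟩
      · rw [restrictElems_cons_notMem v hxA, restrictElems_cons_mem v hxA] at hx
        exact Or.inr ⟨⟨x, hxA⟩, hx⟩
    · rintro (⟨⟨x, hxA⟩, hx⟩ | ⟨⟨x, hxA⟩, hx⟩)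
      · refine ⟨x, ?_⟩
        rwa [restrictElems_cons_mem v hxA, restrictElems_cons_notMem v (not_not.2 hxA)]
      · refine ⟨x, ?_⟩
        rwa [restrictElems_cons_notMem v hxA, restrictElems_cons_mem v hxA]
  | existsSet φ ih =>
    obtain ⟨T, hT, ih⟩ := ih
    -- A subset of `C` is an independent choice of a subset on each side.
    refine ⟨Set T, inferInstance, fun C _ A hA => ?_⟩
    obtain ⟨a, b, Rel, h⟩ := ih C A hA
    refine ⟨fun v V => range fun X : Set A => a v (Fin.cons X V),
      fun v V => range fun X : Set ↥Aᶜ => b v (Fin.cons X V),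
      fun s t => ∃ p ∈ s, ∃ q ∈ t, Rel p q, fun v V => ?_⟩
    simp only [MSOFormula.Sat, h, exists_range_iff, restrictSets_cons]
    constructor
    · rintro ⟨X, hX⟩
      exact ⟨_, _, hX⟩
    · rintro ⟨X, Y, hXY⟩
      refine ⟨Subtype.val '' X ∪ Subtype.val '' Y, ?_⟩
      have hA : (Subtype.val ⁻¹' (Subtype.val '' X ∪ Subtype.val '' Y) : Set A) = X := by
        ext x
        have := x.2
        simp
      have hB : (Subtype.val ⁻¹' (Subtype.val '' X ∪ Subtype.val '' Y) : Set ↥Aᶜ) = Y := by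
        ext x
        have : x.1 ∉ A := x.2
        simp [this]
      rwa [hA, hB]

/-! ### Definable orders and cuts -/

/-- Every cut of `C` splits `R` into boundedly many convex pieces, each on one side of the cut. -/
def CutsFinitely {C : Type u} [LinearOrder C] (R : C → C → Prop) (T : Type) : Prop :=
  ∀ A : Set C, IsLowerSet A → ∃ c : C → T,
    (∀ x y z, c x = c z → R x y → R y z → c y = c x) ∧ ∀ x y, c x = c y → x ∈ A → y ∈ A

/-- Colour a point by its side and by the types of the points across the cut that lie `R`-above it.
This set of types shrinks along `R`, so it is constant between two points of equal colour. A point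
across the cut cannot lie between them: its type would also occur above the upper one. -/
theorem MSODefinable.exists_cutsFinitely {C : Type u} [LinearOrder C] {R : C → C → Prop}
    [IsWellOrder C R] (hR : MSODefinable R) : ∃ T : Type, Finite T ∧ CutsFinitely R T := by
  obtain ⟨l, φ, Q, hφ⟩ := hR
  obtain ⟨T, hT, h⟩ := φ.composition.{u}
  refine ⟨Set T ⊕ Set T, inferInstance, fun A hA => ?_⟩
  obtain ⟨a₀, b₀, Rel, h⟩ := h C A hA
  obtain ⟨a, b, hab⟩ : ∃ a b : C → T, ∀ x ∈ A, ∀ y ∉ A, R x y ↔ Rel (a x) (b y) := by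
    classical
    refine ⟨fun x => a₀ ![if h : x ∈ A then some ⟨x, h⟩ else none, none] (restrictSets A Q),
      fun y => b₀ ![none, if h : y ∈ Aᶜ then some ⟨y, h⟩ else none] (restrictSets Aᶜ Q),
      fun x hx y hy => ?_⟩
    rw [hφ, h]
    congr! 2
    · funext i
      fin_cases i <;> simp [restrictElems, hx, hy]
    · funext i
      fin_cases i <;> simp [restrictElems, hx, hy]
  classical
  refine ⟨fun x => if x ∈ A then Sum.inl {t | ∃ y ∉ A, b y = t ∧ R x y}
    else Sum.inr {t | ∃ y ∈ A, a y = t ∧ R x y}, fun x y z hxz hxy hyz => ?_, fun x y hxy hx => ?_⟩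
  · by_cases hx : x ∈ A
    · have hz : z ∈ A := by
        by_contra hz
        simp [hx, hz] at hxz
      simp only [hx, hz, if_true, Sum.inl.injEq] at hxz
      have key : ∀ w ∉ A, R x w → R z w := fun w hw hxw => by
        obtain ⟨w', hw', hww', hzw'⟩ : b w ∈ {t | ∃ y ∉ A, b y = t ∧ R z y} :=
          hxz ▸ ⟨w, hw, rfl, hxw⟩
        rw [hab z hz w hw, ← hww']
        exact (hab z hz w' hw').1 hzw'
      have hy : y ∈ A := by
        by_contra hy
        exact asymm_of R hyz (key y hy hxy)
      simp only [hx, hy, if_true, Sum.inl.injEq]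
      ext t
      exact ⟨fun ⟨w, hw, hwt, hyw⟩ => ⟨w, hw, hwt, trans_of R hxy hyw⟩,
        fun ⟨w, hw, hwt, hxw⟩ => ⟨w, hw, hwt, trans_of R hyz (key w hw hxw)⟩⟩
    · have hz : z ∉ A := by
        intro hz
        simp [hx, hz] at hxz
      simp only [hx, hz, if_false, Sum.inr.injEq] at hxz
      have key : ∀ w ∈ A, R x w → R z w := fun w hw hxw => by
        obtain ⟨w', hw', hww', hzw'⟩ : a w ∈ {t | ∃ y ∈ A, a y = t ∧ R z y} :=
          hxz ▸ ⟨w, hw, rfl, hxw⟩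
        rcases trichotomous_of R w z with h | h | h
        · rw [hab w hw z hz, ← hww', ← hab w' hw' z hz] at h
          exact (asymm_of R h hzw').elim
        · exact (hz (h ▸ hw)).elim
        · exact h
      have hy : y ∉ A := fun hy => asymm_of R hyz (key y hy hxy)
      simp only [hx, hy, if_false, Sum.inr.injEq]
      ext t
      exact ⟨fun ⟨w, hw, hwt, hyw⟩ => ⟨w, hw, hwt, trans_of R hxy hyw⟩,
        fun ⟨w, hw, hwt, hxw⟩ => ⟨w, hw, hwt, trans_of R hyz (key w hw hxw)⟩⟩
  · by_contra hy
    simp [hx, hy] at hxy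

/-! ### Order types of subsets and indecomposability of `ω ^ γ` -/

section OrderType

variable {C : Type u} (r : C → C → Prop) [IsWellOrder C r]

/-- The order type of the subset `S` under the well order `r`. -/
noncomputable def otp (S : Set C) : Ordinal.{u} := type (Subrel r (· ∈ S))

variable {r}

theorem otp_mono {S S' : Set C} (h : S ⊆ S') : otp r S ≤ otp r S' :=
  (Subrel.inclusionEmbedding r h).ordinal_type_le

theorem otp_union {A B : Set C} (h : ∀ x ∈ A, ∀ y ∈ B, r x y) :
    otp r (A ∪ B) = otp r A + otp r B := by
  classical
  have hd : Disjoint A B := Set.disjoint_left.2 fun x hx hx' => irrefl_of r x (h x hx x hx')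
  rw [otp, otp, otp, ← type_sum_lex]
  refine (RelIso.ordinalType_congr ⟨(Equiv.Set.union hd).symm, ?_⟩).symm
  rintro (x | x) (y | y)
  · simp [Subrel]
  · simp [Subrel, h _ x.2 _ y.2]
  · have := asymm_of r (h _ y.2 _ x.2)
    simp [Subrel, this]
  · simp [Subrel]

theorem otp_univ : otp r univ = type r :=
  RelIso.ordinalType_congr ⟨Equiv.Set.univ C, Iff.rfl⟩

theorem otp_empty : otp r ∅ = 0 := by
  rw [otp, type_eq_zero_iff_isEmpty]
  infer_instance

theorem otp_eq_zero {S : Set C} : otp r S = 0 ↔ S = ∅ := by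
  rw [otp, type_eq_zero_iff_isEmpty]
  exact isEmpty_coe_sort

theorem otp_singleton (x : C) : otp r {x} = 1 :=
  type_eq_one_of_unique _

theorem exists_rank_eq {S : Set C} {o : Ordinal.{u}} (h : o < otp r S) :
    ∃ x ∈ S, otp r (S ∩ {y | r y x}) = o := by
  obtain ⟨x, rfl⟩ := typein_surj _ h
  refine ⟨x, x.2, ?_⟩
  rw [← type_subrel]
  refine RelIso.ordinalType_congr ⟨⟨fun y => ⟨⟨y.1, y.2.1⟩, y.2.2⟩, fun y => ⟨y.1.1, y.1.2, y.2⟩,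
    fun _ => rfl, fun _ => rfl⟩, Iff.rfl⟩

theorem exists_cut {S : Set C} {o : Ordinal.{u}} (h : o ≤ otp r S) :
    ∃ A B, S = A ∪ B ∧ (∀ x ∈ A, ∀ y ∈ B, r x y) ∧ otp r A = o := by
  rcases h.eq_or_lt with rfl | h
  · exact ⟨S, ∅, by simp, by simp, rfl⟩
  obtain ⟨x, hx, rfl⟩ := exists_rank_eq h
  refine ⟨S ∩ {y | r y x}, S ∩ {y | ¬ r y x}, ?_, ?_, rfl⟩
  · rw [← inter_union_distrib_left]
    ext y
    simp [em]
  · rintro y ⟨-, hy⟩ z ⟨-, hz⟩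
    rcases trichotomous_of r x z with h | rfl | h
    · exact trans_of r hy h
    · exact hy
    · exact (hz h).elim

theorem otp_le_one_iff {S : Set C} : otp r S ≤ 1 ↔ S.Subsingleton := by
  constructor
  · intro h x hx y hy
    by_contra hne
    wlog hxy : r x y generalizing x y
    · rcases trichotomous_of r x y with h | h | h
      · exact hxy h
      · exact hne h
      · exact this hy hx (Ne.symm hne) h
    have h2 : otp r ({x} ∪ {y}) ≤ 1 :=
      (otp_mono (union_subset (singleton_subset_iff.2 hx) (singleton_subset_iff.2 hy))).trans h
    rw [otp_union (by simpa using hxy), otp_singleton, otp_singleton] at h2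
    exact absurd h2 (by norm_num)
  · intro h
    rcases h.eq_empty_or_singleton with rfl | ⟨x, rfl⟩
    · simp [otp_empty]
    · rw [otp_singleton]

/-- Cut off `n` consecutive blocks of type `ω ^ γ`; each is large in `S` or in `S'`, and `a`, `b`
count the two cases. -/
theorem exists_otp_inter_ge {γ : Ordinal.{u}} {S S' : Set C}
    (ih : ∀ X ⊆ S ∪ S', ω ^ γ ≤ otp r X → ω ^ γ ≤ otp r (X ∩ S) ∨ ω ^ γ ≤ otp r (X ∩ S')) (n : ℕ) :
    ∀ X ⊆ S ∪ S', ω ^ γ * n ≤ otp r X → ∃ a b : ℕ, a + b = n ∧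
      ω ^ γ * a ≤ otp r (X ∩ S) ∧ ω ^ γ * b ≤ otp r (X ∩ S') := by
  induction n with
  | zero => exact fun X _ _ => ⟨0, 0, by simp⟩
  | succ n IH =>
    intro X hX h
    rw [Nat.cast_succ, mul_add_one] at h
    obtain ⟨A, B, rfl, hAB, hA⟩ := exists_cut (le_self_add.trans h)
    rw [otp_union hAB, hA, add_le_add_iff_left] at h
    obtain ⟨hAX, hBX⟩ := union_subset_iff.1 hX
    obtain ⟨a, b, rfl, ha, hb⟩ := IH A hAX hA.ge
    have hU : ∀ T : Set C, otp r ((A ∪ B) ∩ T) = otp r (A ∩ T) + otp r (B ∩ T) := fun T => by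
      rw [union_inter_distrib_right, otp_union]
      exact fun x hx y hy => hAB x hx.1 y hy.1
    rw [hU, hU]
    rcases ih B hBX h with h | h
    · refine ⟨a + 1, b, by ring, ?_, hb.trans le_self_add⟩
      rw [Nat.cast_succ, mul_add_one]
      exact add_le_add ha h
    · refine ⟨a, b + 1, by ring, ha.trans le_self_add, ?_⟩
      rw [Nat.cast_succ, mul_add_one]
      exact add_le_add hb h

theorem opow_le_otp_union (γ : Ordinal.{u}) : ∀ {S S' : Set C}, ω ^ γ ≤ otp r (S ∪ S') →
    ω ^ γ ≤ otp r S ∨ ω ^ γ ≤ otp r S' := by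
  induction γ using WellFoundedLT.induction with
  | ind γ IH =>
  intro S S' h
  by_contra! hlt
  rcases eq_or_ne γ 0 with rfl | h0
  · simp only [opow_zero, Order.lt_one_iff, otp_eq_zero] at hlt
    simp [hlt.1, hlt.2, otp_empty] at h
  obtain ⟨c, hc, m, hm⟩ := (lt_omega0_opow h0).1 hlt.1
  obtain ⟨c', hc', m', hm'⟩ := (lt_omega0_opow h0).1 hlt.2
  obtain ⟨d, hd, k, hk, hk'⟩ : ∃ d < γ, ∃ k : ℕ, otp r S < ω ^ d * k ∧ otp r S' < ω ^ d * k := by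
    refine ⟨max c c', max_lt hc hc', max m m', hm.trans_le ?_, hm'.trans_le ?_⟩
    · exact mul_le_mul' (opow_le_opow_right omega0_pos (le_max_left _ _)) (by simp)
    · exact mul_le_mul' (opow_le_opow_right omega0_pos (le_max_right _ _)) (by simp)
  -- Of `2 * k` blocks, `S` or `S'` must receive at least `k`, against the bounds just found.
  have hX : ω ^ d * (2 * k : ℕ) ≤ otp r (S ∪ S') :=
    (opow_mul_lt_opow (natCast_lt_omega0 _) hd).le.trans h
  obtain ⟨a, b, hab, ha, hb⟩ := exists_otp_inter_ge (γ := d) (S := S) (S' := S') (r := r)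
    (fun X hX hX' => IH d hd (by rwa [← inter_union_distrib_left, inter_eq_left.2 hX])) _ _
    subset_rfl hX
  have hka : a < k := by
    have := ((ha.trans (otp_mono inter_subset_right)).trans_lt hk)
    exact_mod_cast lt_of_mul_lt_mul_left' this
  have hkb : b < k := by
    have := ((hb.trans (otp_mono inter_subset_right)).trans_lt hk')
    exact_mod_cast lt_of_mul_lt_mul_left' this
  omega

theorem otp_union_lt {γ : Ordinal.{u}} {S S' : Set C} (h : otp r S < ω ^ γ)
    (h' : otp r S' < ω ^ γ) : otp r (S ∪ S') < ω ^ γ := by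
  by_contra! hle
  rcases opow_le_otp_union γ hle with H | H
  · exact h.not_ge H
  · exact h'.not_ge H

theorem exists_fiber_ge {γ : Ordinal.{u}} {T : Type*} [Finite T] (c : C → T) {S : Set C}
    (h : ω ^ γ ≤ otp r S) : ∃ t, ω ^ γ ≤ otp r (S ∩ c ⁻¹' {t}) := by
  by_contra! hlt
  suffices H : ∀ F : Set T, otp r (S ∩ c ⁻¹' F) < ω ^ γ by
    have := H univ
    rw [preimage_univ, inter_univ] at this
    exact this.not_ge h
  intro F
  induction F, F.toFinite using Set.Finite.induction_on with
  | empty => simpa [otp_empty] using opow_pos γ omega0_pos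
  | @insert t F _ _ ih =>
    rw [insert_eq, preimage_union, inter_union_distrib_left]
    exact otp_union_lt (hlt t) ih

end OrderType

/-! ### Comparison of the two order types -/

/-- A block inserted at any position is not lost: if `b` falls short of `ω ^ γ * n`, its remainder
modulo `ω ^ γ` is already absorbed by `c`. -/
theorem opow_mul_succ_le_add_add {γ b c : Ordinal.{u}} {n : ℕ} (h : ω ^ γ * n ≤ b + c) :
    ω ^ γ * (n + 1 : ℕ) ≤ b + (ω ^ γ + c) := by
  set w := ω ^ γ with hw
  have hpos : 0 < w := opow_pos _ omega0_pos
  rcases le_or_gt (w * n) b with hb | hb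
  · rw [Nat.cast_succ, mul_add_one]
    exact add_le_add hb le_self_add
  have hdiv : b / w < n := (lt_mul_iff_div_lt hpos.ne').1 hb
  obtain ⟨m, hm⟩ := lt_omega0.1 (hdiv.trans (natCast_lt_omega0 n))
  have hmn : m < n := by rw [hm] at hdiv; exact_mod_cast hdiv
  obtain ⟨k, rfl⟩ : ∃ k, n = m + (k + 1) := ⟨n - m - 1, by omega⟩
  have hbm : w * m + b % w = b := by rw [← hm, div_add_mod]
  have hr : b % w < w := mod_lt _ hpos.ne'
  rw [← hbm, Nat.cast_add, mul_add, add_assoc, add_le_add_iff_left] at h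
  have hwk : w ≤ w * (k + 1 : ℕ) := le_mul_left _ (by simp)
  have hc : w ≤ c := by
    by_contra! hc
    exact (hwk.trans h).not_gt (isPrincipal_add_omega0_opow γ hr hc)
  rw [add_of_omega0_opow_le hr hc] at h
  calc w * (m + (k + 1) + 1 : ℕ) = w * m + (w + w * (k + 1 : ℕ)) := by
        rw [show m + (k + 1) + 1 = m + (1 + (k + 1)) by ring, Nat.cast_add, mul_add, Nat.cast_add,
          mul_add, Nat.cast_one, mul_one]
    _ ≤ w * m + (w + c) := by gcongr
    _ ≤ b + (w + c) := by
        gcongr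
        rw [← hbm]
        exact le_self_add

section CutsFinitely

variable {C : Type u} [LinearOrder C] {R : C → C → Prop} [IsWellOrder C R]
  {T : Type} [Finite T]

/-- Cut above `A`. One colour class `A'` of `A` still has `R`-type at least `ω ^ γ`, and by
convexity no point of `B` lies `R`-between its points. So `A'` is inserted whole into `B`. -/
theorem CutsFinitely.opow_mul_succ_le_otp_union (hR : CutsFinitely R T) {γ : Ordinal.{u}} {n : ℕ}
    {A B : Set C} (hAB : ∀ x ∈ A, ∀ y ∈ B, x < y) (hA : ω ^ γ ≤ otp R A)
    (hB : ω ^ γ * n ≤ otp R B) : ω ^ γ * (n + 1 : ℕ) ≤ otp R (A ∪ B) := by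
  obtain ⟨c, hc, hcD⟩ := hR {z | ∃ x ∈ A, z ≤ x}
    (fun y z hzy ⟨x, hx, hyx⟩ => ⟨x, hx, hzy.trans hyx⟩)
  obtain ⟨t, ht⟩ := exists_fiber_ge c hA
  have hne : ∀ x ∈ A, ∀ y ∈ B, c x ≠ c y := fun x hx y hy hxy => by
    obtain ⟨z, hz, hyz⟩ := hcD x y hxy ⟨x, hx, le_rfl⟩
    exact (hAB z hz y hy).not_ge hyz
  set A' := A ∩ c ⁻¹' {t} with hA'
  set B₀ := {y ∈ B | ∀ x ∈ A', R y x} with hB₀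
  set B₁ := {y ∈ B | ∀ x ∈ A', R x y} with hB₁
  obtain ⟨a, ha⟩ : A'.Nonempty := by
    rw [nonempty_iff_ne_empty, ne_eq, ← otp_eq_zero (r := R)]
    exact ((opow_pos γ omega0_pos).trans_le ht).ne'
  have hBu : B = B₀ ∪ B₁ := by
    ext y
    refine ⟨fun hy => ?_, fun h => h.elim And.left And.left⟩
    rcases trichotomous_of R y a with h | h | h
    · refine Or.inl ⟨hy, fun x hx => ?_⟩
      rcases trichotomous_of R y x with h' | rfl | h'
      · exact h'
      · exact (hne _ hx.1 _ hy rfl).elim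
      · exact (hne x hx.1 y hy (hc x y a (hx.2.trans ha.2.symm) h' h).symm).elim
    · exact (hne a ha.1 y hy (h ▸ rfl)).elim
    · refine Or.inr ⟨hy, fun x hx => ?_⟩
      rcases trichotomous_of R x y with h' | rfl | h'
      · exact h'
      · exact (hne _ hx.1 _ hy rfl).elim
      · exact (hne a ha.1 y hy (hc a y x (ha.2.trans hx.2.symm) h h').symm).elim
  have h01 : ∀ x ∈ B₀, ∀ y ∈ B₁, R x y := fun x hx y hy => trans_of R (hx.2 a ha) (hy.2 a ha)
  have h1 : otp R (A' ∪ B₁) = otp R A' + otp R B₁ := otp_union fun x hx y hy => hy.2 x hx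
  have h0 : otp R (B₀ ∪ (A' ∪ B₁)) = otp R B₀ + (otp R A' + otp R B₁) := by
    rw [← h1, otp_union]
    rintro x hx y (hy | hy)
    exacts [hx.2 y hy, h01 x hx y hy]
  rw [hBu, otp_union h01] at hB
  refine (opow_mul_succ_le_add_add hB).trans ?_
  calc _ ≤ otp R B₀ + (otp R A' + otp R B₁) := by gcongr
    _ ≤ otp R (A ∪ B) := by
      rw [← h0]
      refine otp_mono (union_subset ?_ (union_subset ?_ ?_))
      exacts [(sep_subset _ _).trans subset_union_right, inter_subset_left.trans subset_union_left,
        (sep_subset _ _).trans subset_union_right]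

variable [WellFoundedLT C]

/-- A least counterexample type `η` is additively principal, hence `ω ^ δ` with `δ < γ`. Splitting
off an initial `ω ^ δ` leaves two parts of `R`-type at least `ω ^ δ`, so the whole has at least `ω ^
δ * 2`. -/
theorem CutsFinitely.opow_le_otp (hR : CutsFinitely R T) (γ : Ordinal.{u}) :
    ∀ {X : Set C}, ω ^ γ ≤ otp LT.lt X → ω ^ γ ≤ otp R X := by
  induction γ using WellFoundedLT.induction with
  | ind γ IH =>
  by_contra! hX
  obtain ⟨X, hX, hXlt⟩ := hX
  set E : Set Ordinal.{u} := {o | ∃ Y : Set C, ω ^ γ ≤ otp LT.lt Y ∧ otp R Y = o} with hE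
  have hne : E.Nonempty := ⟨_, X, hX, rfl⟩
  obtain ⟨Y, hY, hYη⟩ := csInf_mem hne
  set η := sInf E with hη
  have hηlt : η < ω ^ γ := (csInf_le' (show otp R X ∈ E from ⟨X, hX, rfl⟩)).trans_lt hXlt
  have hprin : IsPrincipal (· + ·) η := by
    rw [isPrincipal_add_iff_add_left_eq_self]
    intro b hb
    obtain ⟨Y₀, Y₁, rfl, h01, hb0⟩ := exists_cut (hb.le.trans hYη.ge)
    rcases opow_le_otp_union γ hY with h | h
    · exact absurd (csInf_le' ⟨Y₀, h, rfl⟩ : η ≤ _) (by rw [hb0]; exact hb.not_ge)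
    · have h1 : η ≤ otp R Y₁ := csInf_le' ⟨Y₁, h, rfl⟩
      rw [otp_union h01, hb0] at hYη
      refine le_antisymm ?_ le_add_self
      calc b + η ≤ b + otp R Y₁ := by gcongr
        _ = η := hYη
  rcases isPrincipal_add_iff_zero_or_omega0_opow.1 hprin with h0 | ⟨δ, hδ⟩
  · rw [h0, otp_eq_zero] at hYη
    rw [hYη, otp_empty] at hY
    exact (opow_pos γ omega0_pos).not_ge hY
  · dsimp only at hδ
    have hδγ : δ < γ := by
      rw [← hδ] at hηlt
      exact (opow_lt_opow_iff_right one_lt_omega0).1 hηlt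
    have hle : ω ^ δ ≤ ω ^ γ := opow_le_opow_right omega0_pos hδγ.le
    obtain ⟨A, B, rfl, hAB, hA⟩ := exists_cut (hle.trans hY)
    rw [otp_union hAB, hA] at hY
    have hB : ω ^ γ ≤ otp LT.lt B := by
      by_contra! hB
      exact hY.not_gt (isPrincipal_add_omega0_opow γ (hδ ▸ hηlt) hB)
    have := hR.opow_mul_succ_le_otp_union (n := 1) hAB (IH δ hδγ hA.ge)
      (by simpa using IH δ hδγ (hle.trans hB))
    rw [hYη, ← hδ, Nat.cast_add, mul_add, Nat.cast_one, mul_one] at this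
    exact this.not_gt (lt_add_of_pos_right _ (opow_pos δ omega0_pos))

theorem CutsFinitely.opow_mul_le_otp (hR : CutsFinitely R T) (γ : Ordinal.{u}) (n : ℕ) :
    ∀ {X : Set C}, ω ^ γ * n ≤ otp LT.lt X → ω ^ γ * n ≤ otp R X := by
  induction n with
  | zero => simp
  | succ n ih =>
    intro X hX
    rw [add_comm, Nat.cast_add, mul_add, Nat.cast_one, mul_one] at hX
    obtain ⟨A, B, rfl, hAB, hA⟩ := exists_cut (le_self_add.trans hX)
    rw [otp_union hAB, hA, add_le_add_iff_left] at hX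
    exact hR.opow_mul_succ_le_otp_union hAB (hR.opow_le_otp γ hA.ge) (ih hX)

/-- Otherwise mark the points of `R`-rank `ω ^ γ * i` for `i ≤ Nat.card T` and cut just above all of
them. Two marks share a colour, so the `R`-interval between them, of type at least `ω ^ γ`, lies
below the cut, where the `<`-type is less than `ω ^ γ`. -/
theorem CutsFinitely.otp_le_opow_mul_card (hR : CutsFinitely R T) {γ : Ordinal.{u}}
    (ih : ∀ Y : Set C, otp LT.lt Y < ω ^ γ → otp R Y < ω ^ γ) {X : Set C}
    (hX : otp LT.lt X ≤ ω ^ γ) : otp R X ≤ ω ^ γ * Nat.card T := by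
  rcases X.eq_empty_or_nonempty with rfl | ⟨x₀, hx₀⟩
  · simp [otp_empty]
  have hT : Nonempty T := (hR univ isLowerSet_univ).elim fun c _ => ⟨c x₀⟩
  by_contra! hlt
  have hp : ∀ i : Fin (Nat.card T + 1), ∃ x ∈ X, otp R (X ∩ {y | R y x}) = ω ^ γ * (i : ℕ) :=
    fun i => exists_rank_eq (lt_of_le_of_lt
      (mul_le_mul_right (by exact_mod_cast Nat.lt_succ_iff.1 i.2) _) hlt)
  choose p hpX hpr using hp
  obtain ⟨c, hc, hcD⟩ := hR {z | ∃ i, z ≤ p i} (fun y z hzy ⟨i, hi⟩ => ⟨i, hzy.trans hi⟩)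
  obtain ⟨i, j, hij, hcij⟩ : ∃ i j, i < j ∧ c (p i) = c (p j) := by
    obtain ⟨i, j, hne, h⟩ := Fintype.exists_ne_map_eq_of_card_lt
      (fun i : Fin (Nat.card T + 1) => (Finite.equivFin T) (c (p i))) (by simp)
    rw [EmbeddingLike.apply_eq_iff_eq] at h
    rcases hne.lt_or_gt with h' | h'
    exacts [⟨i, j, h', h⟩, ⟨j, i, h', h.symm⟩]
  have hsmall : otp LT.lt (X ∩ {z | ∃ i, z ≤ p i}) < ω ^ γ := by
    rcases eq_or_ne γ 0 with rfl | h0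
    · rw [opow_zero, otp_le_one_iff] at hX
      have hrank := (hpr i).symm.trans (hX (hpX i) (hpX j) ▸ hpr j)
      rw [opow_zero, one_mul, one_mul, Nat.cast_inj] at hrank
      exact absurd (Fin.ext hrank) hij.ne
    obtain ⟨k, hk⟩ := Finite.exists_max p
    have hlt : otp LT.lt (X ∩ {y | y < p k}) < ω ^ γ := by
      refine lt_of_lt_of_le (lt_add_one _) (le_trans ?_ hX)
      rw [← otp_singleton (r := LT.lt) (p k), ← otp_union (by rintro x ⟨-, hx⟩ y rfl; exact hx)]
      exact otp_mono (union_subset inter_subset_left (singleton_subset_iff.2 (hpX k)))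
    have h1 : otp LT.lt {p k} < ω ^ γ := by
      rw [otp_singleton]
      exact one_lt_opow.2 ⟨one_lt_omega0, h0⟩
    refine (otp_mono ?_).trans_lt (otp_union_lt hlt h1)
    rintro y ⟨hyX, l, hy⟩
    exact (hy.trans (hk l)).lt_or_eq.imp (fun h => ⟨hyX, h⟩) id
  have hbig : ω ^ γ ≤ otp R (X ∩ {z | ∃ i, z ≤ p i}) := by
    have hpp : R (p i) (p j) := by
      rcases trichotomous_of R (p i) (p j) with h | h | h
      · exact h
      · have hrank := (hpr i).symm.trans (h ▸ hpr j)
        rw [mul_left_cancel_iff_of_pos (opow_pos γ omega0_pos), Nat.cast_inj] at hrank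
        exact absurd (Fin.ext hrank) hij.ne
      · have hle : otp R (X ∩ {y | R y (p j)}) ≤ otp R (X ∩ {y | R y (p i)}) :=
          otp_mono (inter_subset_inter_right _ fun y hy => trans_of R hy h)
        rw [hpr, hpr, mul_le_mul_iff_right₀ (opow_pos γ omega0_pos), Nat.cast_le] at hle
        exact absurd hle (not_le.2 hij)
    set J := X ∩ {y | R y (p j) ∧ ¬ R y (p i)} with hJ
    have hJsub : J ⊆ X ∩ {z | ∃ i, z ≤ p i} := by
      rintro y ⟨hyX, hy, hy'⟩
      rcases trichotomous_of R y (p i) with h | rfl | h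
      · exact (hy' h).elim
      · exact ⟨hyX, i, le_rfl⟩
      · exact ⟨hyX, hcD (p i) y (hc _ _ _ hcij h hy).symm ⟨i, le_rfl⟩⟩
    have hsplit : X ∩ {y | R y (p j)} = (X ∩ {y | R y (p i)}) ∪ J := by
      ext y
      constructor
      · rintro ⟨hyX, hy⟩
        by_cases h : R y (p i)
        exacts [Or.inl ⟨hyX, h⟩, Or.inr ⟨hyX, hy, h⟩]
      · rintro (⟨hyX, hy⟩ | ⟨hyX, hy, -⟩)
        exacts [⟨hyX, trans_of R hy hpp⟩, ⟨hyX, hy⟩]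
    have hsum := hpr j
    rw [hsplit, otp_union, hpr] at hsum
    · have hle : ω ^ γ * ((i : ℕ) + 1 : ℕ) ≤ ω ^ γ * ((j : ℕ) : Ordinal.{u}) :=
        mul_le_mul_right (by exact_mod_cast hij) _
      rw [← hsum, Nat.cast_succ, mul_add_one, add_le_add_iff_left] at hle
      exact hle.trans (otp_mono hJsub)
    · rintro x ⟨-, hx⟩ y ⟨-, -, hy⟩
      rcases trichotomous_of R x y with h | rfl | h
      exacts [h, (hy hx).elim, (hy (trans_of R h hx)).elim]
  exact hbig.not_gt (ih _ hsmall)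

theorem CutsFinitely.otp_lt_opow (hR : CutsFinitely R T) (γ : Ordinal.{u}) :
    ∀ {X : Set C}, otp LT.lt X < ω ^ γ → otp R X < ω ^ γ := by
  induction γ using WellFoundedLT.induction with
  | ind γ IH =>
  intro X hX
  rcases eq_or_ne γ 0 with rfl | h0
  · simp only [opow_zero, Order.lt_one_iff, otp_eq_zero] at hX ⊢
    exact hX
  obtain ⟨δ, hδ, n, hn⟩ := (lt_omega0_opow h0).1 hX
  suffices H : ∀ n : ℕ, ∀ X : Set C, otp LT.lt X ≤ ω ^ δ * n → otp R X < ω ^ γ from H n X hn.le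
  intro n
  induction n with
  | zero =>
    intro X hX
    simp only [Nat.cast_zero, mul_zero, nonpos_iff_eq_zero, otp_eq_zero] at hX
    rw [hX, otp_empty]
    exact opow_pos γ omega0_pos
  | succ n ih =>
    intro X hX
    rcases le_total (otp LT.lt X) (ω ^ δ * n) with h | h
    · exact ih X h
    obtain ⟨A, B, rfl, hAB, hA⟩ := exists_cut h
    -- The last block `B` has `<`-type at most `ω ^ δ`.
    rw [otp_union hAB, hA, Nat.cast_succ, mul_add_one, add_le_add_iff_left] at hX
    refine otp_union_lt (ih A hA.le) ?_
    exact (hR.otp_le_opow_mul_card (fun Y => IH δ hδ) hX).trans_lt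
      (opow_mul_lt_opow (natCast_lt_omega0 _) hδ)

end CutsFinitely

/-! ### Rearranging ordinals by finitely many colours -/

/-- Some well order of type `β` arises from a well order of type `α` by colouring it with finitely
many linearly ordered colours and sorting by colour first. -/
def Rearranges (α β : Ordinal.{u}) : Prop :=
  ∃ (C : Type u) (r s : C → C → Prop) (_ : IsWellOrder C r) (_ : IsWellOrder C s) (ι : Type u)
    (_ : LinearOrder ι) (_ : Finite ι) (c : C → ι),
    (∀ x y, s x y ↔ c x < c y ∨ c x = c y ∧ r x y) ∧ type r = α ∧ type s = β

theorem Rearranges.refl (α : Ordinal.{u}) : Rearranges α α :=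
  ⟨α.ToType, LT.lt, LT.lt, inferInstance, inferInstance, PUnit, inferInstance, inferInstance,
    fun _ => ⟨⟩, by simp, type_toType α, type_toType α⟩

theorem Rearranges.add {α α' β β' : Ordinal.{u}} (h : Rearranges α β) (h' : Rearranges α' β') :
    Rearranges (α + α') (β + β') := by
  obtain ⟨C, r, s, _, _, ι, _, _, c, hc, rfl, rfl⟩ := h
  obtain ⟨C', r', s', _, _, ι', _, _, c', hc', rfl, rfl⟩ := h'
  refine ⟨C ⊕ C', Sum.Lex r r', Sum.Lex s s', inferInstance, inferInstance, ι ⊕ₗ ι', inferInstance,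
    inferInstanceAs (Finite (ι ⊕ ι')),
    Sum.elim (fun x => Sum.inlₗ (c x)) (fun x => Sum.inrₗ (c' x)), ?_, rfl, rfl⟩
  rintro (x | x) (y | y) <;> simp [hc, hc']

theorem Rearranges.add_swap {α α' β β' : Ordinal.{u}} (h : Rearranges α β)
    (h' : Rearranges α' β') : Rearranges (α + α') (β' + β) := by
  obtain ⟨C, r, s, _, _, ι, _, _, c, hc, rfl, rfl⟩ := h
  obtain ⟨C', r', s', _, _, ι', _, _, c', hc', rfl, rfl⟩ := h'
  let e : (Equiv.sumComm C C') ⁻¹'o Sum.Lex s' s ≃r Sum.Lex s' s := RelIso.preimage _ _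
  have he : IsWellOrder (C ⊕ C') ((Equiv.sumComm C C') ⁻¹'o Sum.Lex s' s) :=
    e.toRelEmbedding.isWellOrder
  refine ⟨C ⊕ C', Sum.Lex r r', (Equiv.sumComm C C') ⁻¹'o Sum.Lex s' s, inferInstance, he,
    ι' ⊕ₗ ι, inferInstance, inferInstanceAs (Finite (ι' ⊕ ι)),
    Sum.elim (fun x => Sum.inrₗ (c x)) (fun x => Sum.inlₗ (c' x)), ?_, rfl, ?_⟩
  · rintro (x | x) (y | y) <;> simp [hc, hc', Order.Preimage]
  · rw [← type_sum_lex]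
    exact e.ordinalType_congr

theorem Rearranges.natCast_mul (k : ℕ) (α : Ordinal.{u}) : Rearranges (k * α) (α * k) := by
  let K := (k : Ordinal.{u}).ToType
  let s : K × α.ToType → K × α.ToType → Prop := Prod.Lex LT.lt LT.lt
  let e : (Equiv.prodComm α.ToType K) ⁻¹'o s ≃r s := RelIso.preimage _ _
  have he : IsWellOrder (α.ToType × K) ((Equiv.prodComm α.ToType K) ⁻¹'o s) :=
    e.toRelEmbedding.isWellOrder
  have hK : Finite K := by
    rw [← Cardinal.lt_aleph0_iff_finite, Cardinal.mk_toType, card_nat]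
    exact Cardinal.natCast_lt_aleph0
  refine ⟨α.ToType × K, Prod.Lex LT.lt LT.lt, _, inferInstance, he, K, inferInstance, hK,
    Prod.snd, ?_, ?_, ?_⟩
  · rintro ⟨x, i⟩ ⟨y, j⟩
    simp only [Order.Preimage, s, Prod.lex_def, Equiv.prodComm_apply, Prod.swap]
    refine or_congr_right (and_congr_right fun h => ?_)
    simp [h]
  · rw [type_prod_lex]
    simp [K]
  · rw [e.ordinalType_congr, type_prod_lex]
    simp [K]

theorem natCast_mul_omega0_opow {k : ℕ} (hk : k ≠ 0) {γ : Ordinal.{u}} (hγ : γ ≠ 0) :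
    k * ω ^ γ = ω ^ γ := by
  obtain ⟨δ, rfl⟩ : ∃ δ, γ = 1 + δ :=
    ⟨γ - 1, (Ordinal.add_sub_cancel_of_le (Order.one_le_iff_pos.2 (pos_iff_ne_zero.2 hγ))).symm⟩
  rw [opow_add, opow_one, ← mul_assoc, natCast_mul_omega0 (Nat.pos_of_ne_zero hk)]

/-- With `w = ω ^ γ`, keep all but one copy of `w`. View the last one as `δ + w` with `δ = β % w`,
split its `w` into `k + 1` interleaved copies, and move `δ` to the end. The tail `ε` of `α` moves to
the front and is absorbed. -/
theorem Rearranges.of_opow_mul_le {γ α β : Ordinal.{u}} (hγ : γ ≠ 0) {n : ℕ} (hn : n ≠ 0)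
    (hα : ω ^ γ * n ≤ α) (hα' : α < ω ^ γ * (n + 1 : ℕ)) (hβ : ω ^ γ * n ≤ β)
    (hβ' : β < ω ^ Order.succ γ) : Rearranges α β := by
  set w := ω ^ γ with hw
  have hpos : w ≠ 0 := (opow_pos _ omega0_pos).ne'
  obtain ⟨ε, rfl⟩ := exists_add_of_le hα
  rw [Nat.cast_succ, mul_add_one, add_lt_add_iff_left] at hα'
  have hdiv : β / w < ω := by
    rw [← lt_mul_iff_div_lt hpos]
    rwa [opow_succ] at hβ'
  obtain ⟨m, hm⟩ := lt_omega0.1 hdiv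
  have hmn : n ≤ m := by
    have := (mul_le_iff_le_div hpos).1 hβ
    rw [hm] at this
    exact_mod_cast this
  obtain ⟨k, rfl⟩ : ∃ k, m = (n - 1) + (k + 1) := ⟨m - n, by omega⟩
  obtain ⟨l, rfl⟩ : ∃ l, n = l + 1 := ⟨n - 1, by omega⟩
  have hδ : β % w < w := mod_lt _ hpos
  rw [← div_add_mod β w, hm]
  have h1 : Rearranges w (w * (k + 1 : ℕ)) := by
    have := Rearranges.natCast_mul (k + 1) w
    rwa [hw, natCast_mul_omega0_opow k.succ_ne_zero hγ] at this
  have h2 : Rearranges w (w * (k + 1 : ℕ) + β % w) := by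
    have := (Rearranges.refl (β % w)).add_swap h1
    rwa [add_omega0_opow hδ] at this
  have h3 : Rearranges (w + ε) (w * (k + 1 : ℕ) + β % w) := by
    have := h2.add_swap (Rearranges.refl ε)
    rwa [← add_assoc, add_of_omega0_opow_le hα'] at this
    exact le_mul_left _ (by simp)
  have h4 := (Rearranges.refl (w * l)).add h3
  rwa [← add_assoc, ← add_assoc, ← mul_add_one, ← mul_add, ← Nat.cast_succ, ← Nat.cast_add] at h4

theorem Rearranges.exists_coloring {C : Type u} {r R : C → C → Prop} [IsWellOrder C r]
    [IsWellOrder C R] (h : Rearranges (type r) (type R)) :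
    ∃ (n : ℕ) (c : C → Fin n) (s : C → C → Prop), Function.Surjective c ∧
      (∀ x y, s x y ↔ c x < c y ∨ c x = c y ∧ r x y) ∧ Nonempty (R ≃r s) := by
  obtain ⟨D, r', s, _, _, ι, _, _, c, hc, hr, hs⟩ := h
  obtain ⟨e⟩ := type_eq.1 hr
  obtain ⟨f⟩ := type_eq.1 hs
  have := Fintype.ofFinite (range c)
  let g : Fin (Fintype.card (range c)) ≃o range c := Fintype.orderIsoFinOfCardEq _ rfl
  refine ⟨Fintype.card (range c), fun x => g.symm ⟨c (e.symm x), mem_range_self _⟩,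
    e.symm.toEquiv ⁻¹'o s, fun i => ?_, fun x y => ?_, ⟨f.symm.trans ⟨e.toEquiv, ?_⟩⟩⟩
  · obtain ⟨x, hx⟩ := (g i).2
    refine ⟨e x, ?_⟩
    simp [hx]
  · simp [Order.Preimage, hc, e.symm.map_rel_iff]
  · simp [Order.Preimage]

/-! ### Block orders and their definability -/

theorem blockOrder_preimage_singleton {C : Type*} [LT C] {n : ℕ} (c : C → Fin n) (x y : C) :
    blockOrder (fun k => c ⁻¹' {k}) x y ↔ c x < c y ∨ c x = c y ∧ x < y := by
  simp only [blockOrder, mem_preimage, mem_singleton_iff]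
  constructor
  · rintro (⟨k, hx, hy, h⟩ | ⟨k, l, rfl, rfl, h⟩)
    exacts [Or.inr ⟨hx.trans hy.symm, h⟩, Or.inl h]
  · rintro (h | ⟨h, h'⟩)
    exacts [Or.inr ⟨_, _, rfl, rfl, h⟩, Or.inl ⟨_, rfl, h.symm, h'⟩]

theorem IsFinPartition.exists_eq_preimage {C : Type*} {n : ℕ} {P : Fin n → Set C}
    (hP : IsFinPartition P) : ∃ c : C → Fin n, P = fun k => c ⁻¹' {k} := by
  obtain ⟨-, hd, hU⟩ := hP
  have : ∀ x, ∃ k, x ∈ P k := fun x => mem_iUnion.1 (hU ▸ mem_univ x)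
  choose c hc using this
  refine ⟨c, funext fun k => ext fun x => ⟨fun hx => ?_, ?_⟩⟩
  · by_contra hne
    exact Set.disjoint_left.1 (hd _ _ hne) (hc x) hx
  · rintro rfl
    exact hc x

theorem isFinPartition_preimage {C : Type*} {n : ℕ} {c : C → Fin n} (hc : Function.Surjective c) :
    IsFinPartition fun k => c ⁻¹' {k} :=
  ⟨fun k => (hc k).imp fun _ h => h,
    fun _ _ hne => Set.disjoint_left.2 fun _ hx hy => hne (hx.symm.trans hy),
    eq_univ_of_forall fun x => mem_iUnion.2 ⟨c x, rfl⟩⟩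

theorem IsFinPartition.isWellOrder_blockOrder {C : Type*} [LinearOrder C] [WellFoundedLT C] {n : ℕ}
    {P : Fin n → Set C} (hP : IsFinPartition P) : IsWellOrder C (blockOrder P) := by
  obtain ⟨c, rfl⟩ := hP.exists_eq_preimage
  have f : blockOrder (fun k => c ⁻¹' {k}) ↪r
      (Prod.Lex LT.lt LT.lt : Fin n × C → Fin n × C → Prop) :=
    ⟨⟨fun x => (c x, x), fun x y h => (Prod.ext_iff.1 h).2⟩, by
      intro x y
      rw [blockOrder_preimage_singleton, Prod.lex_def]
      rfl⟩
  exact f.isWellOrder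

theorem MSOFormula.exists_disjunction {ι : Type*} {m l : ℕ} (f : ι → MSOFormula (m + 1) l)
    (F : Finset ι) : ∃ φ : MSOFormula (m + 1) l, ∀ (C : Type u) [LT C] (v : Fin (m + 1) → C)
      (V : Fin l → Set C), φ.Sat v V ↔ ∃ i ∈ F, (f i).Sat v V := by
  classical
  induction F using Finset.induction_on with
  -- The empty disjunction is `x ≠ x`, which needs a free element variable.
  | empty => exact ⟨.neg (.eq 0 0), by simp [MSOFormula.Sat]⟩
  | insert i F _ ih =>
    obtain ⟨φ, hφ⟩ := ih
    refine ⟨.neg (.and (.neg (f i)) (.neg φ)), fun C _ v V => ?_⟩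
    simp only [MSOFormula.Sat, hφ, Finset.exists_mem_insert]
    rw [not_and_or, not_not, not_not]

theorem msoDefinable_blockOrder {C : Type u} [LT C] {n : ℕ} (P : Fin n → Set C) :
    MSODefinable (blockOrder P) := by
  classical
  obtain ⟨φ, hφ⟩ := MSOFormula.exists_disjunction.{u} (m := 1)
    (fun k : Fin n => .and (.mem 0 k) (.and (.mem 1 k) (.lt 0 1))) Finset.univ
  obtain ⟨ψ, hψ⟩ := MSOFormula.exists_disjunction.{u} (m := 1)
    (fun p : Fin n × Fin n => .and (.mem 0 p.1) (.mem 1 p.2))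
    (Finset.univ.filter fun p => p.1 < p.2)
  refine ⟨n, .neg (.and (.neg φ) (.neg ψ)), P, fun x y => ?_⟩
  simp only [MSOFormula.Sat, hφ, hψ, not_and_or, not_not, blockOrder]
  refine or_congr (by simp) ?_
  simp only [Finset.mem_filter, Finset.mem_univ, true_and, Prod.exists]
  exact exists₂_congr fun k l => by simp; tauto

/-! ### Conclusion -/

theorem MSODefinable.rearranges {C : Type u} [LinearOrder C] [WellFoundedLT C] {R : C → C → Prop}
    [IsWellOrder C R] (hR : MSODefinable R) : Rearranges (type (LT.lt : C → C → Prop)) (type R) := by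
  obtain ⟨T, _, hT⟩ := hR.exists_cutsFinitely
  set α := type (LT.lt : C → C → Prop) with hα
  -- For finite `α` the cardinality decides the type; infinite `α` has `γ ≠ 0`, as absorption
  -- requires.
  rcases lt_or_ge α ω with hfin | hinf
  · have hcard : (type R).card = α.card := rfl
    obtain ⟨n, hn⟩ := lt_omega0.1 hfin
    rw [hn, card_nat, card_eq_nat] at hcard
    rw [hcard, hn]
    exact Rearranges.refl _
  set γ := log ω α with hγ
  have h0 : α ≠ 0 := (omega0_pos.trans_le hinf).ne'
  have hpos : ω ^ γ ≠ 0 := (opow_pos γ omega0_pos).ne'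
  obtain ⟨n, hn⟩ := lt_omega0.1 (div_opow_log_lt α one_lt_omega0)
  have hle : ω ^ γ * n ≤ α := by
    rw [← hn]
    exact mul_div_le _ _
  refine Rearranges.of_opow_mul_le (log_pos one_lt_omega0 h0 hinf).ne' (n := n) ?_ hle ?_ ?_ ?_
  · rintro rfl
    exact (div_opow_log_pos ω h0).ne' (by rw [hn, Nat.cast_zero])
  · rw [lt_mul_iff_div_lt hpos, hn]
    exact_mod_cast n.lt_succ_self
  · rw [← otp_univ]
    exact hT.opow_mul_le_otp γ n (by rwa [otp_univ])
  · rw [← otp_univ]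
    refine hT.otp_lt_opow _ ?_
    rw [otp_univ]
    exact lt_opow_succ_log_self one_lt_omega0 α

theorem theorem4p7 (α : Ordinal) :
    (∀ R : α.ToType → α.ToType → Prop, IsWellOrder α.ToType R → MSODefinable R →
      ∃ (n : ℕ) (P : Fin n → Set α.ToType), IsFinPartition P ∧ Nonempty (R ≃r blockOrder P)) ∧
    (∀ (n : ℕ) (P : Fin n → Set α.ToType), IsFinPartition P →
      IsWellOrder α.ToType (blockOrder P) ∧ MSODefinable (blockOrder P)) := by
  refine ⟨fun R _ hR => ?_, fun n P hP => ⟨hP.isWellOrder_blockOrder, msoDefinable_blockOrder P⟩⟩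
  obtain ⟨n, c, s, hc, hs, he⟩ := hR.rearranges.exists_coloring
  refine ⟨n, _, isFinPartition_preimage hc, ?_⟩
  rwa [show blockOrder (fun k => c ⁻¹' {k}) = s by
    ext x y
    rw [blockOrder_preimage_singleton, hs]]
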